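/- Let $n$ be a positive integer, and for integers $1\le i,j\le n+1$ let $$J_{i,j}(q)=\sum_{k=-n}^{n+1}(-1)^{k+1}\,\frac{q^k-q^{-k}}{q-q^{-1}}\binom{2j+k-3}{i-1}\left[q\binom{n}{j+k-2}+\binom{n}{j+k-1}\right]\in\mathbb{Z}[q,q^{-1}],$$ where $\binom{a}{b}=a(a-1)\cdots(a-b+1)/b!$ for integers $a$ and $b\ge 0$, and $\binom{a}{b}=0$ for $b<0$. Then the coefficients of $$q^{-1-\frac n2}\,\det\bigl(J_{i,j}(q)\bigr)_{1\le i,j\le n+1}$$ (a Laurent polynomial in $q^{1/2}$) are symmetric: for every rational number $r$ the coefficients of $q^{r}$ and of $q^{-r}$ are equal. That is, this expression is invariant under $q\mapsto q^{-1}$. -/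

import Mathlib

open scoped LaurentPolynomial

namespace JDet

noncomputable section

/-- The indeterminate `q` of the ring `ℤ[q, q⁻¹]` of integer Laurent polynomials is
`LaurentPolynomial.T 1`, and `q ^ k` is `LaurentPolynomial.T k` for every integer `k`. This is the
quotient `(q ^ k - q ^ (-k)) / (q - q⁻¹)`, written out as the Laurent polynomial
`sign k * (q ^ (|k| - 1) + q ^ (|k| - 3) + ⋯ + q ^ (1 - |k|))`;
see `qInt_eq_iff` for the fact that it is that quotient. -/
def qInt (k : ℤ) : ℤ[T;T⁻¹] :=
  LaurentPolynomial.C k.sign *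
    ∑ l ∈ Finset.range k.natAbs, LaurentPolynomial.T ((k.natAbs : ℤ) - 1 - 2 * (l : ℤ))

theorem sub_mul_geom (m : ℕ) :
    ((LaurentPolynomial.T 1 - LaurentPolynomial.T (-1) : ℤ[T;T⁻¹]) *
      ∑ l ∈ Finset.range m, LaurentPolynomial.T ((m : ℤ) - 1 - 2 * (l : ℤ))) =
      LaurentPolynomial.T (m : ℤ) - LaurentPolynomial.T (-(m : ℤ)) := by
  have h := Finset.sum_range_sub'
    (fun l : ℕ => (LaurentPolynomial.T ((m : ℤ) - 2 * (l : ℤ)) : ℤ[T;T⁻¹])) m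
  rw [Finset.mul_sum]
  have e : (m : ℤ) - 2 * (m : ℤ) = -(m : ℤ) := by ring
  simp only [Nat.cast_zero, mul_zero, sub_zero, e] at h
  rw [← h]
  refine Finset.sum_congr rfl fun l _ => ?_
  rw [sub_mul, ← LaurentPolynomial.T_add, ← LaurentPolynomial.T_add]
  congr 2 <;> push_cast <;> ring

theorem sub_mul_qInt (k : ℤ) :
    (LaurentPolynomial.T 1 - LaurentPolynomial.T (-1) : ℤ[T;T⁻¹]) * qInt k =
      LaurentPolynomial.T k - LaurentPolynomial.T (-k) := by
  unfold qInt
  rw [mul_left_comm, sub_mul_geom]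
  rcases lt_trichotomy k 0 with h | h | h
  · have e : (k.natAbs : ℤ) = -k := by omega
    rw [e, Int.sign_eq_neg_one_of_neg h]
    simp
  · subst h
    simp
  · have e : (k.natAbs : ℤ) = k := by omega
    rw [e, Int.sign_eq_one_of_pos h]
    simp

/-- `qInt k` is the unique quotient of `q ^ k - q ^ (-k)` by `q - q⁻¹`. -/
theorem qInt_eq_iff (k : ℤ) (P : ℤ[T;T⁻¹]) :
    P = qInt k ↔ P * (LaurentPolynomial.T 1 - LaurentPolynomial.T (-1)) =
      LaurentPolynomial.T k - LaurentPolynomial.T (-k) := by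
  have hne : (LaurentPolynomial.T 1 - LaurentPolynomial.T (-1) : ℤ[T;T⁻¹]) ≠ 0 := by
    intro h
    have h1 := congrArg (fun f : ℤ[T;T⁻¹] => f.coeff 1) h
    simp [LaurentPolynomial.T_apply] at h1
  rw [← sub_mul_qInt k, mul_comm P]
  exact ⟨fun h => by rw [h], fun h => mul_left_cancel₀ hne h⟩

/-- The binomial coefficient `a (a - 1) ⋯ (a - b + 1) / b!` for integers `a` and `b`, which is `0`
if `b < 0`. -/
def binom (a b : ℤ) : ℤ :=
  if b < 0 then 0 else Ring.choose a b.toNat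

/-- The Laurent polynomial `J_{i,j}(q)`, for indices `i, j` that start at `1`. -/
def J (n : ℕ) (i j : ℤ) : ℤ[T;T⁻¹] :=
  ∑ k ∈ Finset.Icc (-(n : ℤ)) ((n : ℤ) + 1),
    LaurentPolynomial.C ((Int.negOnePow (k + 1) : ℤˣ) : ℤ) * qInt k *
      LaurentPolynomial.C (binom (2 * j + k - 3) (i - 1)) *
      (LaurentPolynomial.T 1 * LaurentPolynomial.C (binom n (j + k - 2)) +
        LaurentPolynomial.C (binom n (j + k - 1)))

/-- The determinant of `(J_{i,j}(q))` over `1 ≤ i, j ≤ n + 1`; an index `a : Fin (n + 1)` stands for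
`a + 1`. -/
def detJ (n : ℕ) : ℤ[T;T⁻¹] :=
  (Matrix.of fun i j : Fin (n + 1) => J n ((i : ℕ) + 1) ((j : ℕ) + 1)).det

/-- Laurent polynomials in `q` as elements of the ring `ℤ[ℚ]` of finite integer combinations of
powers `q ^ r` with rational exponents `r`, where `q ^ r` is `AddMonoidAlgebra.single r 1`. -/
def toRatPowers : ℤ[T;T⁻¹] →+* AddMonoidAlgebra ℤ ℚ :=
  AddMonoidAlgebra.mapDomainRingHom ℤ (Int.castAddHom ℚ)

/-- The substitution `q ↦ q⁻¹`, which sends `q ^ r` to `q ^ (-r)` for every rational `r`. -/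
def substInv : AddMonoidAlgebra ℤ ℚ →+* AddMonoidAlgebra ℤ ℚ :=
  AddMonoidAlgebra.mapDomainRingHom ℤ (negAddMonoidHom : ℚ →+ ℚ)

/-- The expression `q ^ (-1 - n / 2) * det (J_{i,j}(q))`. -/
def normalizedDetJ (n : ℕ) : AddMonoidAlgebra ℤ ℚ :=
  AddMonoidAlgebra.single (-1 - (n : ℚ) / 2) 1 * toRatPowers (detJ n)

end

end JDet

/-! Write x = 1 + X. Column a of the matrix consists of the first n + 1 Taylor coefficients of one
power series. After multiplication by (q - q⁻¹)x, the binomial theorem sums that series in closed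
form (`mul_columnSeries`). Adding q⁻¹ times the preceding column makes every column but the first
divisible by X, so the determinant drops to size n (`reducedColumn_succ`, `coeffDet_eq_of_succ`).
Cancelling (q - q⁻¹)^(n+1) leaves det J = (-1)^n q (1 - q)^n D, where the columns of D are odd under
q ↦ q⁻¹ (`detJ_eq`). Inversion thus multiplies D by (-1)^n and det J by q^(-n-2), which the
prefactor q^(-1-n/2) balances. -/

namespace JDet

open PowerSeries

/-! ### Determinants of Taylor coefficients -/

section TaylorDeterminants

variable {R : Type*} [CommRing R]

/-- The determinant of the first `m` coefficients of `m` power series. -/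
noncomputable def coeffDet {m : ℕ} (f : Fin m → R⟦X⟧) : R :=
  (Matrix.of fun i j : Fin m => coeff (i : ℕ) (f j)).det

/-- Multiplication by `u` acts on truncated coefficient vectors as a lower triangular Toeplitz
matrix with diagonal `constantCoeff u`. -/
theorem coeffDet_mul_left {m : ℕ} (u : R⟦X⟧) (f : Fin m → R⟦X⟧) :
    coeffDet (fun j => u * f j) = constantCoeff u ^ m * coeffDet f := by
  let L : Matrix (Fin m) (Fin m) R :=
    Matrix.of fun i l => if l ≤ i then coeff ((i : ℕ) - l) u else 0
  have hL : L.det = constantCoeff u ^ m := by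
    rw [Matrix.det_of_isLowerTriangular]
    · simp [L]
    · intro i l h
      have h' : i < l := h
      simp [L, not_le.mpr h']
  unfold coeffDet
  rw [← hL, ← Matrix.det_mul]
  congr 1
  ext i j
  rw [Matrix.mul_apply]
  simp only [Matrix.of_apply, L]
  rw [mul_comm u, coeff_mul, Finset.Nat.sum_antidiagonal_eq_sum_range_succ_mk]
  have h := Fin.sum_univ_eq_sum_range
    (fun l => (if l ≤ (i : ℕ) then coeff ((i : ℕ) - l) u else 0) * coeff l (f j)) m
  simp only [Fin.le_def]
  rw [h]
  have hsub : Finset.range ((i : ℕ) + 1) ⊆ Finset.range m :=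
    Finset.range_subset_range.mpr i.2
  rw [← Finset.sum_subset hsub]
  · refine Finset.sum_congr rfl fun l hl => ?_
    rw [if_pos (Nat.lt_succ_iff.mp (Finset.mem_range.mp hl)), mul_comm]
  · intro l _ hl
    rw [if_neg (by simpa [Nat.lt_succ_iff] using hl), zero_mul]

/-- Column operations leave a top row that is zero after its first entry; the factor X shifts the
remaining rows down by one. -/
theorem coeffDet_eq_of_succ {m : ℕ} (c : R) (f : Fin (m + 1) → R⟦X⟧) (g : Fin m → R⟦X⟧)
    (h : ∀ j : Fin m, f j.succ + PowerSeries.C c * f j.castSucc = X * g j) :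
    coeffDet f = constantCoeff (f 0) * coeffDet g := by
  let B : Matrix (Fin (m + 1)) (Fin (m + 1)) R :=
    Matrix.of fun i => Fin.cons (coeff (i : ℕ) (f 0)) fun j => coeff (i : ℕ) (X * g j)
  have hB : coeffDet f = B.det := by
    refine Matrix.det_eq_of_forall_col_eq_smul_add_pred (fun _ => -c) (fun i => ?_) fun i j => ?_
    · simp [B]
    · simp only [B, Matrix.of_apply, Fin.cons_succ, ← h, map_add, coeff_C_mul]
      ring
  rw [hB, Matrix.det_succ_row_zero, Fin.sum_univ_succ, Finset.sum_eq_zero, add_zero]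
  · simp only [Fin.val_zero, pow_zero, one_mul]
    congr 1
    · simp [B]
    · unfold coeffDet
      congr 1
      ext i j
      simp [B, coeff_succ_X_mul]
  · intro j _
    simp [B]

end TaylorDeterminants

noncomputable section

/-! ### Closed form of the columns -/

/-- The power series `(1 + X) ^ k` for an integer `k`. -/
def onePow (k : ℤ) : (ℤ[T;T⁻¹])⟦X⟧ := binomialSeries ℤ[T;T⁻¹] k

theorem onePow_add (k l : ℤ) : onePow (k + l) = onePow k * onePow l := binomialSeries_add k l

theorem onePow_natCast (k : ℕ) : onePow k = (1 + X) ^ k := binomialSeries_nat k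

theorem onePow_one : onePow 1 = 1 + X := by simpa using onePow_natCast 1

/-- The power series `(-q ^ s (1 + X)) ^ k` for an integer `k`. -/
def scaledPow (s k : ℤ) : (ℤ[T;T⁻¹])⟦X⟧ :=
  PowerSeries.C (LaurentPolynomial.C ((Int.negOnePow k : ℤˣ) : ℤ) * LaurentPolynomial.T (s * k)) *
    onePow k

/-- The power series `q ^ s (1 + X)`. -/
def scaled (s : ℤ) : (ℤ[T;T⁻¹])⟦X⟧ := PowerSeries.C (LaurentPolynomial.T s) * (1 + X)

theorem scaledPow_add (s k l : ℤ) : scaledPow s (k + l) = scaledPow s k * scaledPow s l := by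
  unfold scaledPow
  rw [onePow_add, Int.negOnePow_add, mul_add, LaurentPolynomial.T_add, Units.val_mul]
  simp only [map_mul]
  ring

theorem scaledPow_one (s : ℤ) : scaledPow s 1 = -scaled s := by
  simp [scaledPow, scaled, onePow_one]

theorem scaledPow_natCast (s : ℤ) (k : ℕ) : scaledPow s k = (-scaled s) ^ k := by
  induction k with
  | zero => simp [scaledPow, onePow]
  | succ k ih => rw [Nat.cast_succ, scaledPow_add, ih, scaledPow_one, pow_succ]

/-- The factor x^(2a), coming from the 2j in the binomial coefficient, turns a negative power into a
natural one and flips the sign of `s`. -/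
theorem onePow_mul_scaledPow (s : ℤ) (a : ℕ) :
    onePow (2 * a) * scaledPow s (-a) = (-scaled (-s)) ^ a := by
  rw [← scaledPow_natCast, scaledPow, scaledPow, mul_left_comm, ← onePow_add, Int.negOnePow_neg]
  congr 3
  · ring_nf
  · ring

/-- The bounds on `c` are exactly what keeps the support -c ≤ k ≤ n - c inside the summation range.
-/
theorem sum_binom_smul {M : Type*} [AddCommGroup M] (n : ℕ) (c : ℤ) (h₁ : -1 ≤ c) (h₂ : c ≤ n)
    (g : ℤ → M) :
    ∑ k ∈ Finset.Icc (-(n : ℤ)) ((n : ℤ) + 1), binom n (k + c) • g k =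
      ∑ m ∈ Finset.range (n + 1), n.choose m • g (m - c) := by
  symm
  refine Finset.sum_of_injOn (fun m : ℕ => (m : ℤ) - c) (fun x _ y _ h => ?_) (fun m hm => ?_)
    (fun k _ hk => ?_) fun m _ => ?_
  · simpa using h
  · simp only [Finset.coe_range, Set.mem_Iio] at hm
    simp only [Finset.coe_Icc, Set.mem_Icc]
    omega
  · unfold binom
    split_ifs with hneg
    · simp
    · obtain ⟨m, hm⟩ := Int.eq_ofNat_of_zero_le (not_lt.mp hneg)
      have hlt : n < m := by
        by_contra hle
        exact hk ⟨m, by simp; omega, by simp; omega⟩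
      rw [hm, Int.toNat_natCast, Ring.choose_natCast, Nat.choose_eq_zero_of_lt hlt]
      simp
  · simp only [sub_add_cancel, binom, Int.toNat_natCast, Ring.choose_natCast]
    rw [if_neg (by omega), Nat.cast_smul_eq_nsmul]

theorem sum_binom_smul_scaledPow (n : ℕ) (s c : ℤ) (h₁ : -1 ≤ c) (h₂ : c ≤ n) :
    ∑ k ∈ Finset.Icc (-(n : ℤ)) ((n : ℤ) + 1), binom n (k + c) • scaledPow s k =
      scaledPow s (-c) * (1 - scaled s) ^ n := by
  rw [sum_binom_smul n c h₁ h₂, sub_eq_neg_add, add_pow, Finset.mul_sum]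
  refine Finset.sum_congr rfl fun m _ => ?_
  rw [sub_eq_neg_add, scaledPow_add, scaledPow_natCast, nsmul_eq_mul, one_pow]
  ring

/-- The power series in `X` whose first `n + 1` coefficients are column `a` (counted from `0`) of
the matrix of the `J_{i,j}`. -/
def columnSeries (n a : ℕ) : (ℤ[T;T⁻¹])⟦X⟧ :=
  ∑ k ∈ Finset.Icc (-(n : ℤ)) ((n : ℤ) + 1),
    PowerSeries.C (LaurentPolynomial.C ((Int.negOnePow (k + 1) : ℤˣ) : ℤ) * qInt k) *
      onePow (2 * a + k - 1) *
      PowerSeries.C (LaurentPolynomial.T 1 * LaurentPolynomial.C (binom n (k + (a - 1))) +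
        LaurentPolynomial.C (binom n (k + a)))

theorem coeff_columnSeries (n a i : ℕ) :
    coeff i (columnSeries n a) = J n ((i : ℤ) + 1) ((a : ℤ) + 1) := by
  unfold columnSeries J
  rw [map_sum]
  refine Finset.sum_congr rfl fun k _ => ?_
  rw [coeff_mul_C, coeff_C_mul, onePow, binomialSeries_coeff]
  have e₁ : 2 * ((a : ℤ) + 1) + k - 3 = 2 * a + k - 1 := by ring
  have e₂ : (a : ℤ) + 1 + k - 2 = k + (a - 1) := by ring
  have e₃ : (a : ℤ) + 1 + k - 1 = k + a := by ring
  have e₄ : binom (2 * a + k - 1) ((i : ℤ) + 1 - 1) = Ring.choose (2 * (a : ℤ) + k - 1) i := by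
    simp [binom]
  rw [e₁, e₂, e₃, e₄, zsmul_one, eq_intCast LaurentPolynomial.C (Ring.choose _ _)]

/-- The closed form of `(q - q⁻¹) (1 + X)` times the series of column `a`; see
`mul_columnSeries`. -/
def reducedColumn (n a : ℕ) : (ℤ[T;T⁻¹])⟦X⟧ :=
  (-scaled 1) ^ a * ((1 - scaled (-1)) ^ n * (1 - scaled 0)) -
    (-scaled (-1)) ^ a * ((1 - scaled 1) ^ n * (1 - scaled 2))

theorem C_T_mul_scaled (s t : ℤ) :
    PowerSeries.C (LaurentPolynomial.T s) * scaled t = scaled (s + t) := by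
  rw [scaled, scaled, ← mul_assoc, ← map_mul, ← LaurentPolynomial.T_add]

theorem sum_scaledPow_mul (n a : ℕ) (ha : a ≤ n) (s : ℤ) :
      ∑ k ∈ Finset.Icc (-(n : ℤ)) ((n : ℤ) + 1), onePow (2 * a) * scaledPow s k *
        PowerSeries.C (LaurentPolynomial.T 1 * LaurentPolynomial.C (binom n (k + (a - 1))) +
          LaurentPolynomial.C (binom n (k + a))) =
      (-scaled (-s)) ^ a * ((1 - scaled s) ^ n * (1 - scaled (1 + s))) := by
  have h₁ := sum_binom_smul_scaledPow n s (a - 1) (by omega) (by omega)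
  have h₂ := sum_binom_smul_scaledPow n s a (by omega) (by omega)
  have e : -((a : ℤ) - 1) = -a + 1 := by ring
  rw [e, scaledPow_add, scaledPow_one] at h₁
  rw [← onePow_mul_scaledPow, ← C_T_mul_scaled]
  calc _ = onePow (2 * a) * (PowerSeries.C (LaurentPolynomial.T 1) *
        ∑ k ∈ Finset.Icc (-(n : ℤ)) ((n : ℤ) + 1), binom n (k + (a - 1)) • scaledPow s k +
        ∑ k ∈ Finset.Icc (-(n : ℤ)) ((n : ℤ) + 1), binom n (k + a) • scaledPow s k) := by
        rw [Finset.mul_sum, ← Finset.sum_add_distrib, Finset.mul_sum]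
        refine Finset.sum_congr rfl fun k _ => ?_
        simp only [map_add, map_mul, eq_intCast, map_intCast, zsmul_eq_mul]
        ring
    _ = _ := by rw [h₁, h₂]; ring

theorem mul_onePow_sub_scaledPow (a k : ℤ) :
    PowerSeries.C (LaurentPolynomial.T 1 - LaurentPolynomial.T (-1)) * (1 + X) *
      (PowerSeries.C (LaurentPolynomial.C ((Int.negOnePow (k + 1) : ℤˣ) : ℤ) * qInt k) *
        onePow (2 * a + k - 1)) =
      onePow (2 * a) * scaledPow (-1) k - onePow (2 * a) * scaledPow 1 k := by
  have hk : onePow (2 * a) * onePow k = (1 + X) * onePow (2 * a + k - 1) := by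
    rw [← onePow_one, ← onePow_add, ← onePow_add]
    congr 1
    ring
  have hq : PowerSeries.C (LaurentPolynomial.T 1 - LaurentPolynomial.T (-1)) *
      PowerSeries.C (qInt k) =
      PowerSeries.C (LaurentPolynomial.T k) - PowerSeries.C (LaurentPolynomial.T (-k)) := by
    rw [← map_mul, sub_mul_qInt, map_sub]
  rw [scaledPow, scaledPow, Int.negOnePow_succ, neg_one_mul, one_mul]
  simp only [map_mul, Units.val_neg, map_neg]
  generalize PowerSeries.C (LaurentPolynomial.C ((Int.negOnePow k : ℤˣ) : ℤ) : ℤ[T;T⁻¹]) = N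
  generalize PowerSeries.C (LaurentPolynomial.T 1 - LaurentPolynomial.T (-1) : ℤ[T;T⁻¹]) = d at *
  generalize PowerSeries.C (qInt k) = Q at *
  linear_combination
    (-N * (1 + X) * onePow (2 * a + k - 1)) * hq +
    (N * (PowerSeries.C (LaurentPolynomial.T k) - PowerSeries.C (LaurentPolynomial.T (-k)))) * hk

theorem mul_columnSeries (n a : ℕ) (ha : a ≤ n) :
    PowerSeries.C (LaurentPolynomial.T 1 - LaurentPolynomial.T (-1)) * (1 + X) *
      columnSeries n a = reducedColumn n a := by
  have hred : reducedColumn n a =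
      (-scaled (- -1)) ^ a * ((1 - scaled (-1)) ^ n * (1 - scaled (1 + -1))) -
      (-scaled (-1)) ^ a * ((1 - scaled 1) ^ n * (1 - scaled (1 + 1))) := by
    norm_num [reducedColumn]
  rw [hred, ← sum_scaledPow_mul n a ha, ← sum_scaledPow_mul n a ha, ← Finset.sum_sub_distrib,
    columnSeries, Finset.mul_sum]
  refine Finset.sum_congr rfl fun k _ => ?_
  rw [← sub_mul, ← mul_onePow_sub_scaledPow]
  simp only [mul_assoc]

/-- A family of power series that changes sign under `q ↦ q⁻¹`. -/
def antiSeries (n a : ℕ) : (ℤ[T;T⁻¹])⟦X⟧ :=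
  (-scaled (-1)) ^ a * (1 - scaled 1) ^ n - (-scaled 1) ^ a * (1 - scaled (-1)) ^ n

/-- The weight q⁻¹ gives each of the two terms the factor it lacks: q⁻¹ - qx = q⁻¹(1 - q²x) and q⁻¹
- q⁻¹x = q⁻¹(1 - x). Both then share (1 - x)(1 - q²x), and 1 - x = -X. -/
theorem reducedColumn_succ (n a : ℕ) :
    reducedColumn n (a + 1) + PowerSeries.C (LaurentPolynomial.T (-1)) * reducedColumn n a =
      X * (PowerSeries.C (LaurentPolynomial.T (-1)) * (1 - scaled 2) * antiSeries n a) := by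
  have h₀ : scaled 0 = 1 + X := by simp [scaled]
  have h₁ : PowerSeries.C (LaurentPolynomial.T (-1)) * scaled 2 = scaled 1 := C_T_mul_scaled _ _
  have h₂ : scaled (-1) = PowerSeries.C (LaurentPolynomial.T (-1)) * (1 + X) := rfl
  unfold reducedColumn antiSeries
  rw [h₀, pow_succ, pow_succ]
  generalize PowerSeries.C (LaurentPolynomial.T (-1) : ℤ[T;T⁻¹]) = t at *
  generalize (1 - scaled (-1)) ^ n = A at *
  generalize (1 - scaled 1) ^ n = B at *
  generalize (-scaled 1) ^ a = P at *
  generalize (-scaled (-1)) ^ a = Q at *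
  rw [h₂, ← h₁]
  ring

theorem constantCoeff_scaled (s : ℤ) : constantCoeff (scaled s) = LaurentPolynomial.T s := by
  simp [scaled]

/-! ### Factorization of the determinant and its symmetry -/

theorem constantCoeff_reducedColumn_zero (n : ℕ) :
    constantCoeff (reducedColumn n 0) =
      (1 - LaurentPolynomial.T 1) ^ n * (LaurentPolynomial.T 2 - 1) := by
  simp only [reducedColumn, map_sub, map_mul, map_pow, map_one, constantCoeff_scaled,
    LaurentPolynomial.T_zero, pow_zero, sub_self]
  ring

theorem invert_antiSeries (n a : ℕ) :
    PowerSeries.map (LaurentPolynomial.invert : ℤ[T;T⁻¹] ≃ₐ[ℤ] ℤ[T;T⁻¹]).toRingEquiv.toRingHom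
      (antiSeries n a) = -antiSeries n a := by
  have h : ∀ s : ℤ, PowerSeries.map
      (LaurentPolynomial.invert : ℤ[T;T⁻¹] ≃ₐ[ℤ] ℤ[T;T⁻¹]).toRingEquiv.toRingHom
      (scaled s) = scaled (-s) := by
    intro s
    simp [scaled]
  simp only [antiSeries, map_sub, map_mul, map_pow, map_neg, map_one, h, neg_neg]
  ring

theorem map_coeffDet {R S : Type*} [CommRing R] [CommRing S] (φ : R →+* S) {m : ℕ}
    (f : Fin m → R⟦X⟧) : φ (coeffDet f) = coeffDet fun j => PowerSeries.map φ (f j) := by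
  unfold coeffDet
  rw [RingHom.map_det]
  congr 1

theorem detJ_eq (n : ℕ) :
    detJ n = (-1) ^ n * LaurentPolynomial.T 1 * (1 - LaurentPolynomial.T 1) ^ n *
      coeffDet fun a : Fin n => antiSeries n a := by
  have hne : (LaurentPolynomial.T 1 - LaurentPolynomial.T (-1) : ℤ[T;T⁻¹]) ≠ 0 := by
    intro h
    have h1 := congrArg (fun f : ℤ[T;T⁻¹] => f.coeff 1) h
    simp [LaurentPolynomial.T_apply] at h1
  have hJ : detJ n = coeffDet fun a : Fin (n + 1) => columnSeries n a := by
    simp only [detJ, coeffDet, coeff_columnSeries]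
  have h₁ := coeffDet_mul_left
    (PowerSeries.C (LaurentPolynomial.T 1 - LaurentPolynomial.T (-1) : ℤ[T;T⁻¹]) * (1 + X))
    fun a : Fin (n + 1) => columnSeries n a
  have h₂ : (fun a : Fin (n + 1) =>
      PowerSeries.C (LaurentPolynomial.T 1 - LaurentPolynomial.T (-1) : ℤ[T;T⁻¹]) * (1 + X) *
        columnSeries n a) = fun a : Fin (n + 1) => reducedColumn n a :=
    funext fun a => mul_columnSeries n a (Nat.lt_succ_iff.mp a.2)
  have h₃ := coeffDet_eq_of_succ (LaurentPolynomial.T (-1))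
    (fun a : Fin (n + 1) => reducedColumn n a) _ fun a => reducedColumn_succ n a
  rw [h₂, ← hJ, h₃, coeffDet_mul_left, Fin.val_zero, constantCoeff_reducedColumn_zero] at h₁
  simp only [map_mul, map_sub, map_add, map_one, constantCoeff_scaled, constantCoeff_C,
    constantCoeff_X, add_zero, mul_one] at h₁
  have e₁ : (LaurentPolynomial.T 2 - 1 : ℤ[T;T⁻¹]) =
      LaurentPolynomial.T 1 * (LaurentPolynomial.T 1 - LaurentPolynomial.T (-1)) := by
    rw [mul_sub, ← LaurentPolynomial.T_add, ← LaurentPolynomial.T_add]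
    simp
  have e₂ : (LaurentPolynomial.T (-1) * (1 - LaurentPolynomial.T 2) : ℤ[T;T⁻¹]) =
      -(LaurentPolynomial.T 1 - LaurentPolynomial.T (-1)) := by
    rw [mul_sub, ← LaurentPolynomial.T_add]
    simp
  rw [e₁, e₂, neg_pow] at h₁
  -- On the reduced side, one factor q - q⁻¹ comes from the corner entry and n from the multiplier
  -- common to the remaining columns.
  refine mul_left_cancel₀ (pow_ne_zero (n + 1) hne) ?_
  rw [← h₁]
  ring

theorem invert_detJ (n : ℕ) :
    LaurentPolynomial.invert (detJ n) = LaurentPolynomial.T (-(n : ℤ) - 2) * detJ n := by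
  have h := map_coeffDet
    (LaurentPolynomial.invert : ℤ[T;T⁻¹] ≃ₐ[ℤ] ℤ[T;T⁻¹]).toRingEquiv.toRingHom
    fun a : Fin n => antiSeries n a
  simp only [invert_antiSeries] at h
  have hneg := coeffDet_mul_left (-1) fun a : Fin n => antiSeries n a
  simp only [neg_one_mul, map_neg, map_one] at hneg
  rw [hneg] at h
  have h' : LaurentPolynomial.invert (coeffDet fun a : Fin n => antiSeries n a) =
      (-1) ^ n * coeffDet fun a : Fin n => antiSeries n a := h
  have e : (1 - LaurentPolynomial.T (-1) : ℤ[T;T⁻¹]) =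
      -(LaurentPolynomial.T (-1) * (1 - LaurentPolynomial.T 1)) := by
    rw [mul_sub, ← LaurentPolynomial.T_add]
    simp
  have ht : (LaurentPolynomial.T (-(n : ℤ) - 2) * LaurentPolynomial.T 1 : ℤ[T;T⁻¹]) =
      LaurentPolynomial.T (-1) * LaurentPolynomial.T (-1) ^ n := by
    rw [LaurentPolynomial.T_pow, ← LaurentPolynomial.T_add, ← LaurentPolynomial.T_add]
    congr 1
    ring
  have hs : ((-1) ^ n * (-1) ^ n : ℤ[T;T⁻¹]) = 1 := by rw [← mul_pow]; simp
  rw [detJ_eq]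
  simp only [map_mul, map_pow, map_sub, map_neg, map_one, LaurentPolynomial.invert_T, h']
  have e' : (1 - LaurentPolynomial.T (-1) : ℤ[T;T⁻¹]) ^ n =
      (-1) ^ n * (LaurentPolynomial.T (-1) ^ n * (1 - LaurentPolynomial.T 1) ^ n) := by
    rw [e, neg_pow (LaurentPolynomial.T (-1) * (1 - LaurentPolynomial.T 1) : ℤ[T;T⁻¹]), mul_pow]
  rw [e']
  generalize coeffDet (fun a : Fin n => antiSeries n a) = D
  generalize (1 - LaurentPolynomial.T 1 : ℤ[T;T⁻¹]) ^ n = A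
  linear_combination (LaurentPolynomial.T (-1) * LaurentPolynomial.T (-1) ^ n * A * D *
    (-1) ^ n) * hs - ((-1) ^ n * A * D) * ht

/-! ### Passage to rational exponents -/

theorem toRatPowers_T (k : ℤ) :
    toRatPowers (LaurentPolynomial.T k) = AddMonoidAlgebra.single (k : ℚ) 1 := by
  unfold LaurentPolynomial.T
  exact AddMonoidAlgebra.mapDomain_single

theorem substInv_single (r : ℚ) (c : ℤ) :
    substInv (AddMonoidAlgebra.single r c) = AddMonoidAlgebra.single (-r) c := by
  simp [substInv]

theorem substInv_toRatPowers (f : ℤ[T;T⁻¹]) :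
    substInv (toRatPowers f) = toRatPowers (LaurentPolynomial.invert f) := by
  induction f using LaurentPolynomial.induction_on' with
  | add p q hp hq => simp only [map_add, hp, hq]
  | C_mul_T k a =>
    simp only [eq_intCast, map_mul, map_intCast, LaurentPolynomial.invert_T, toRatPowers_T,
      substInv_single, Int.cast_neg]

theorem coeff_substInv (f : AddMonoidAlgebra ℤ ℚ) (r : ℚ) :
    (substInv f).coeff (-r) = f.coeff r := by
  simpa [substInv] using
    Finsupp.mapDomain_apply (neg_injective : Function.Injective (Neg.neg : ℚ → ℚ)) f.coeff r

theorem substInv_normalizedDetJ (n : ℕ) : substInv (normalizedDetJ n) = normalizedDetJ n := by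
  rw [normalizedDetJ, map_mul, substInv_single, substInv_toRatPowers, invert_detJ, map_mul,
    toRatPowers_T, ← mul_assoc, AddMonoidAlgebra.single_mul_single]
  congr 2
  push_cast
  ring

end

end JDet

theorem corollary5p3 (n : ℕ) (hn : 1 ≤ n) :
    (∀ r : ℚ, (JDet.normalizedDetJ n).coeff r = (JDet.normalizedDetJ n).coeff (-r)) ∧
      JDet.substInv (JDet.normalizedDetJ n) = JDet.normalizedDetJ n := by
  refine ⟨fun r => ?_, JDet.substInv_normalizedDetJ n⟩
  conv_rhs => rw [← JDet.substInv_normalizedDetJ n]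
  exact (JDet.coeff_substInv _ r).symm
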